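/- Let $n\ge 1$. For a permutation $\sigma$ of $[n]=\{1,\dots,n\}$, a *crossing* of $\sigma$ is a cell $(i,j)\in[n]\times[n]$ with $\sigma(i)<j$ and $i<\sigma^{-1}(j)$; let $\mathrm{Cr}(\sigma)$ be the set of crossings. Consider pairs $(\sigma,E)$ of a permutation $\sigma$ of $[n]$ and a set $E$ of cells (the crossings that have been replaced by elbows); the *remaining crossings* of $(\sigma,E)$ are the elements of $\mathrm{Cr}(\sigma)\setminus E$. A remaining crossing $(i,j)$ is *maximal* if no other remaining crossing $(i',j')$ satisfies $i'\le i$ and $j'\ge j$. A maximal remaining crossing $c=(i,j)$ can be resolved in two ways: *smoothing* replaces $(\sigma,E)$ by $(\sigma,E\cup\{c\})$, and *switching* replaces $(\sigma,E)$ by $(\sigma',E)$, where $\sigma'(i)=j$, $\sigma'(\sigma^{-1}(j))=\sigma(i)$ and $\sigma'(k)=\sigma(k)$ for all other $k$. A permutation $\sigma$ of $[n]$ is a *web permutation* if $(\sigma,\mathrm{Cr}(\sigma))$ can be obtained from $(\mathrm{id},\emptyset)$ by successively resolving maximal remaining crossings. The *Entringer numbers* $E_{n,k}$, $0\le k\le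 n$, are defined by $$\frac{\cos x+\sin x}{\cos(x+y)}=\sum_{m,l\ge 0}E_{m+l,[m,l]}\,\frac{x^m}{m!}\,\frac{y^l}{l!},$$ where $[m,l]=m$ if $m+l$ is odd, and $[m,l]=l$ otherwise. **Corollary (Entringer numbers).** For all integers $n\ge 1$ and $0\le k\le n$, the Entringer number $E_{n,k}$ is equal to the number of web permutations $\sigma$ of $[n]$ with $\sigma(1)=n+1-k$. -/

import Mathlib

/-! ### Grid configurations and web permutations

Indices are zero-based: the element `i` of `Fin n` stands for the number `i + 1` of `[n]`. -/

namespace WebPerm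

/-- The cell `(i, j)` of the `n` by `n` grid, in column `i` and row `j`
(columns counted from left to right, rows from bottom to top). -/
abbrev Cell (n : ℕ) : Type := Fin n × Fin n

/-- The partial order on cells: `CellGE c d` says that `c` lies weakly to the left of and weakly
above `d`, i.e. in the upper-left quadrant at `d`. -/
def CellGE {n : ℕ} (c d : Cell n) : Prop := c.1 ≤ d.1 ∧ d.2 ≤ c.2

/-- The crossings of `σ`. For every `i` the cell `(i, σ i)` is marked, with a horizontal ray to the
left and a vertical ray to the top; `(i, j)` is a crossing if a vertical ray and a horizontal ray
pass through it, i.e. `σ i < j` and `i < σ⁻¹ j`. -/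
def crossings {n : ℕ} (σ : Equiv.Perm (Fin n)) : Finset (Cell n) :=
  Finset.univ.filter fun c => σ c.1 < c.2 ∧ c.1 < σ.symm c.2

/-- The data of a grid configuration `G(σ, E)`: a permutation `σ` and the set `E` of those crossings
of `σ` that have been replaced by elbows. -/
@[ext]
structure GridConfig (n : ℕ) where
  perm : Equiv.Perm (Fin n)
  elbows : Finset (Cell n)

/-- The configuration `G(id, ∅)`. -/
def GridConfig.init (n : ℕ) : GridConfig n := ⟨1, ∅⟩

/-- The crossings that are left in `G(σ, E)`: those of `σ` that are not elbows. -/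
def GridConfig.remaining {n : ℕ} (G : GridConfig n) : Finset (Cell n) :=
  crossings G.perm \ G.elbows

/-- `c` is a crossing of `G`, and there is no other crossing of `G` in the upper-left quadrant
at `c`. -/
def GridConfig.IsMaximalCrossing {n : ℕ} (G : GridConfig n) (c : Cell n) : Prop :=
  c ∈ G.remaining ∧ ∀ d ∈ G.remaining, CellGE d c → d = c

/-- Smoothing: the crossing `c` becomes an elbow. -/
def GridConfig.smooth {n : ℕ} (G : GridConfig n) (c : Cell n) : GridConfig n :=
  ⟨G.perm, insert c G.elbows⟩

/-- Switching at `c = (i, j)`: `σ` becomes the permutation `σ'` with `σ' i = j`,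
`σ' (σ⁻¹ j) = σ i` and `σ' k = σ k` for all other `k`; the elbows stay. -/
def GridConfig.switch {n : ℕ} (G : GridConfig n) (c : Cell n) : GridConfig n :=
  ⟨G.perm * Equiv.swap c.1 (G.perm.symm c.2), G.elbows⟩

/-- One step of the resolving procedure: a maximal crossing is smoothed or switched. -/
inductive Resolves {n : ℕ} : GridConfig n → GridConfig n → Prop
  | smooth (G : GridConfig n) (c : Cell n) (hc : G.IsMaximalCrossing c) : Resolves G (G.smooth c)
  | switch (G : GridConfig n) (c : Cell n) (hc : G.IsMaximalCrossing c) : Resolves G (G.switch c)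

/-- `σ` is a web permutation: a configuration `G(σ, Cr(σ))`, in which no crossing is left, is
obtained from `G(id, ∅)` by resolving maximal crossings one at a time. -/
def IsWeb {n : ℕ} (σ : Equiv.Perm (Fin n)) : Prop :=
  Relation.ReflTransGen Resolves (GridConfig.init n) ⟨σ, crossings σ⟩

end WebPerm

/-! ### Entringer numbers -/

namespace Entringer

/-- The formal power series `(cos x + sin x) / cos (x + y)` over `ℚ`, with `x = X 0` and
`y = X 1`. The denominator has constant coefficient `1`. -/
noncomputable def genFun : MvPowerSeries (Fin 2) ℚ :=
  ((PowerSeries.cos ℚ).subst (MvPowerSeries.X 0 : MvPowerSeries (Fin 2) ℚ)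
      + (PowerSeries.sin ℚ).subst (MvPowerSeries.X 0 : MvPowerSeries (Fin 2) ℚ))
    * ((PowerSeries.cos ℚ).subst
        (MvPowerSeries.X 0 + MvPowerSeries.X 1 : MvPowerSeries (Fin 2) ℚ))⁻¹

/-- `genFun` is the sum of `egfCoeff m l * x ^ m / m! * y ^ l / l!` over all `m, l`. -/
noncomputable def egfCoeff (m l : ℕ) : ℚ :=
  (m.factorial : ℚ) * (l.factorial : ℚ) *
    MvPowerSeries.coeff (Finsupp.single 0 m + Finsupp.single 1 l) genFun

/-- The Entringer number `E_{n,k}`, for `0 ≤ k ≤ n`: the coefficient of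
`x ^ m / m! * y ^ l / l!` in `genFun` is `E_{m+l,[m,l]}`, where `[m,l]` is `m` if `m + l` is odd and
`l` if `m + l` is even. -/
noncomputable def entringer (n k : ℕ) : ℚ :=
  if Odd n then egfCoeff k (n - k) else egfCoeff (n - k) k

end Entringer

/-!
The proof compares two boustrophedon recurrences.

*Generating function.* Let `F = (cos x + sin x) / cos (x + y)`. The derivation `∂/∂x - ∂/∂y` kills
`cos (x + y)`, so it maps `F` to `(cos x - sin x) / cos (x + y) = F (-x, -y)`. Comparing coefficients
gives `E_{n,k} = E_{n,k-1} + E_{n-1,n-k}`, and the parity of `F (0, y) = sec y` and of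
`F (x, 0) - 1 = tan x` gives `E_{n,0} = 0` for `n > 0` (`Entringer.entringer_succ_succ`,
`Entringer.entringer_zero_right`).

*Order of resolution.* Switching at a cell affects only crossings in its lower-right quadrant. Two
distinct maximal crossings are therefore resolved independently of each other, and any maximal
crossing may be resolved first (`WebPerm.GridConfig.reaches_iff`). So the columns may be processed
from left to right, each from the top: column `t`, holding the row `σ t`, either keeps it or exchanges
it with a later column that holds a row above `σ t`. Its row is then final, so different choices give
different web permutations (`WebPerm.isWeb_iff_mem_columnOutcomes`, `WebPerm.card_columnOutcomes`).

*Words.* The number `N(w)` of continuations depends only on the word `w` of rows held by the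
unprocessed columns (`WebPerm.completions`). If the first column takes row `j`, the word
`2 3 ... j-1 1 j+1 ... n` is left (`2 3 ... n` for `j = 1`), so the number of web permutations with
`σ(1) = j` is `N` of this word. For words with distinct letters and `z` smaller than all of them, two
identities hold:
* `N(w v) = N(w) + ∑ N(w with x lowered to z)` over the letters `x < v` of `w`
  (`WebPerm.completions_concat`);
* `N(u z v w) = N(u v z w) + N(u w v)` (`WebPerm.completions_min_swap`).

The second one relates increasing words with a misplaced minimum to increasing words with a misplaced
last letter, and the first one shows that the latter are counted by the former
(`WebPerm.minInsertCount_eq_lastLetterCount`). Together they are the recurrence of the Entringer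
numbers (`WebPerm.minInsertCount_succ_right`).
-/

/-! ### The boustrophedon recurrence of the Entringer numbers -/

namespace Entringer

open MvPowerSeries

/-- The power series `cos x` in the two variables `x`, `y`. -/
noncomputable def cosX : MvPowerSeries (Fin 2) ℚ := (PowerSeries.cos ℚ).subst (X 0)

/-- The power series `sin x` in the two variables `x`, `y`. -/
noncomputable def sinX : MvPowerSeries (Fin 2) ℚ := (PowerSeries.sin ℚ).subst (X 0)

/-- The power series `cos (x + y)`. -/
noncomputable def cosXAddY : MvPowerSeries (Fin 2) ℚ := (PowerSeries.cos ℚ).subst (X 0 + X 1)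

theorem eq_single_zero_iff (e : Fin 2 →₀ ℕ) : e = Finsupp.single 0 (e 0) ↔ e 1 = 0 := by
  constructor
  · intro h
    rw [h]
    simp
  · intro h
    ext i
    fin_cases i <;> simp [h]

theorem coeff_cosX (e : Fin 2 →₀ ℕ) :
    coeff e cosX = if e 1 = 0 then PowerSeries.coeff (e 0) (PowerSeries.cos ℚ) else 0 := by
  simp only [cosX, PowerSeries.coeff_subst_single, eq_single_zero_iff]

theorem coeff_sinX (e : Fin 2 →₀ ℕ) :
    coeff e sinX = if e 1 = 0 then PowerSeries.coeff (e 0) (PowerSeries.sin ℚ) else 0 := by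
  simp only [sinX, PowerSeries.coeff_subst_single, eq_single_zero_iff]

theorem coeff_cosXAddY (e : Fin 2 →₀ ℕ) :
    coeff e cosXAddY =
      (e 0 + e 1).choose (e 0) * PowerSeries.coeff (e 0 + e 1) (PowerSeries.cos ℚ) :=
  PowerSeries.coeff_subst_X_zero_add_X_one _ e

theorem coeff_cos_of_odd {k : ℕ} (hk : Odd k) : PowerSeries.coeff k (PowerSeries.cos ℚ) = 0 := by
  simp [PowerSeries.cos, Nat.not_even_iff_odd.mpr hk]

theorem coeff_sin_of_even {k : ℕ} (hk : Even k) :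
    PowerSeries.coeff k (PowerSeries.sin ℚ) = 0 := by
  simp [PowerSeries.sin, hk]

theorem coeff_cos_succ (k : ℕ) :
    PowerSeries.coeff (k + 1) (PowerSeries.cos ℚ) * (k + 1)
      = -PowerSeries.coeff k (PowerSeries.sin ℚ) := by
  rcases Nat.even_or_odd k with hk | hk
  · rw [coeff_cos_of_odd hk.add_one, coeff_sin_of_even hk]
    simp
  · obtain ⟨r, rfl⟩ := hk
    have h1 : Even (2 * r + 1 + 1) := ⟨r + 1, by ring⟩
    have h2 : ¬ Even (2 * r + 1) := by simp
    have h3 : (2 * r + 1 + 1) / 2 = r + 1 := by omega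
    have h4 : (2 * r + 1) / 2 = r := by omega
    simp only [PowerSeries.cos, PowerSeries.sin, PowerSeries.coeff_mk, h1, h2, if_true, if_false,
      h3, h4, Nat.factorial_succ (2 * r + 1), eq_ratCast, Rat.cast_id]
    have : ((2 * r + 1).factorial : ℚ) ≠ 0 := by positivity
    have : (2 * (r : ℚ) + 1 + 1) ≠ 0 := by positivity
    push_cast
    field_simp
    ring

theorem coeff_sin_succ (k : ℕ) :
    PowerSeries.coeff (k + 1) (PowerSeries.sin ℚ) * (k + 1)
      = PowerSeries.coeff k (PowerSeries.cos ℚ) := by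
  rcases Nat.even_or_odd k with hk | hk
  · obtain ⟨r, rfl⟩ := hk
    have h1 : ¬ Even (r + r + 1) := by simp
    have h2 : Even (r + r) := ⟨r, rfl⟩
    have h3 : (r + r + 1) / 2 = r := by omega
    have h4 : (r + r) / 2 = r := by omega
    simp only [PowerSeries.cos, PowerSeries.sin, PowerSeries.coeff_mk, h1, h2, if_true, if_false,
      h3, h4, Nat.factorial_succ (r + r), eq_ratCast, Rat.cast_id]
    have : ((r + r).factorial : ℚ) ≠ 0 := by positivity
    have : ((r : ℚ) + r + 1) ≠ 0 := by positivity
    push_cast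
    field_simp
  · rw [coeff_sin_of_even hk.add_one, coeff_cos_of_odd hk]
    simp

/-- The derivation `∂/∂x - ∂/∂y`, which annihilates every power series in `x + y`. -/
noncomputable def diffDeriv :
    Derivation ℚ (MvPowerSeries (Fin 2) ℚ) (MvPowerSeries (Fin 2) ℚ) :=
  pderiv ℚ 0 - pderiv ℚ 1

theorem coeff_diffDeriv (e : Fin 2 →₀ ℕ) (f : MvPowerSeries (Fin 2) ℚ) :
    coeff e (diffDeriv f) = coeff (e + Finsupp.single 0 1) f * (e 0 + 1)
      - coeff (e + Finsupp.single 1 1) f * (e 1 + 1) := by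
  simp [diffDeriv, coeff_pderiv]

theorem diffDeriv_cosX : diffDeriv cosX = -sinX := by
  ext e
  rw [coeff_diffDeriv, map_neg, coeff_cosX, coeff_cosX, coeff_sinX]
  by_cases h : e 1 = 0
  · simp [h, coeff_cos_succ]
  · simp [h]

theorem diffDeriv_sinX : diffDeriv sinX = cosX := by
  ext e
  rw [coeff_diffDeriv, coeff_sinX, coeff_sinX, coeff_cosX]
  by_cases h : e 1 = 0
  · simp [h, coeff_sin_succ]
  · simp [h]

theorem diffDeriv_cosXAddY : diffDeriv cosXAddY = 0 := by
  ext e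
  rw [coeff_diffDeriv, coeff_cosXAddY, coeff_cosXAddY, LinearMap.map_zero]
  have h := Nat.choose_succ_right_eq (e 0 + e 1 + 1) (e 0)
  rw [show e 0 + e 1 + 1 - e 0 = e 1 + 1 by omega] at h
  have h' : ((e 0 + e 1 + 1).choose (e 0 + 1) : ℚ) * (e 0 + 1)
      = (e 0 + e 1 + 1).choose (e 0) * (e 1 + 1) := by exact_mod_cast h
  simp only [Finsupp.add_apply, Finsupp.single_eq_same, ne_eq, zero_ne_one, one_ne_zero,
    not_false_eq_true, Finsupp.single_eq_of_ne, add_zero]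
  rw [show e 0 + 1 + e 1 = e 0 + e 1 + 1 by ring, show e 0 + (e 1 + 1) = e 0 + e 1 + 1 by ring]
  linear_combination (PowerSeries.coeff (e 0 + e 1 + 1) (PowerSeries.cos ℚ)) * h'

theorem coeff_rescale_two (a b : ℚ) (e : Fin 2 →₀ ℕ) (f : MvPowerSeries (Fin 2) ℚ) :
    coeff e (rescale ![a, b] f) = a ^ e 0 * b ^ e 1 * coeff e f := by
  rw [coeff_rescale, Finsupp.prod_fintype _ _ (by simp)]
  simp [Fin.prod_univ_two]

theorem rescale_neg_cosX (b : ℚ) : rescale ![-1, b] cosX = cosX := by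
  ext e
  rw [coeff_rescale_two, coeff_cosX]
  split_ifs with h
  · rcases Nat.even_or_odd (e 0) with h0 | h0
    · simp [h, h0.neg_one_pow]
    · simp [coeff_cos_of_odd h0]
  · simp

theorem rescale_neg_sinX (b : ℚ) : rescale ![-1, b] sinX = -sinX := by
  ext e
  rw [coeff_rescale_two, map_neg, coeff_sinX]
  split_ifs with h
  · rcases Nat.even_or_odd (e 0) with h0 | h0
    · simp [coeff_sin_of_even h0]
    · simp [h, h0.neg_one_pow]
  · simp

theorem rescale_neg_cosXAddY : rescale ![-1, -1] cosXAddY = cosXAddY := by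
  ext e
  rw [coeff_rescale_two, coeff_cosXAddY, ← pow_add]
  rcases Nat.even_or_odd (e 0 + e 1) with h | h
  · rw [h.neg_one_pow, one_mul]
  · rw [coeff_cos_of_odd h]
    simp

theorem constantCoeff_cosXAddY : constantCoeff cosXAddY = 1 := by
  rw [← coeff_zero_eq_constantCoeff_apply, coeff_cosXAddY]
  simp [PowerSeries.cos]

theorem cosXAddY_ne_zero : cosXAddY ≠ 0 := by
  intro h
  simpa [h] using constantCoeff_cosXAddY

theorem genFun_mul_cosXAddY : genFun * cosXAddY = cosX + sinX := by
  change (cosX + sinX) * cosXAddY⁻¹ * cosXAddY = _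
  rw [mul_assoc, MvPowerSeries.inv_mul_cancel _ (by simp [constantCoeff_cosXAddY]), mul_one]

/-- With `F` the generating function, `∂F/∂x - ∂F/∂y = F (-x, -y)`: both sides times `cos (x + y)`
are `cos x - sin x`. -/
theorem diffDeriv_genFun : diffDeriv genFun = rescale ![-1, -1] genFun := by
  apply mul_right_cancel₀ cosXAddY_ne_zero
  have h1 := congrArg diffDeriv genFun_mul_cosXAddY
  rw [Derivation.leibniz, diffDeriv_cosXAddY, map_add, diffDeriv_cosX, diffDeriv_sinX] at h1
  have h2 := congrArg (rescale ![(-1 : ℚ), -1]) genFun_mul_cosXAddY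
  rw [map_mul, map_add, rescale_neg_cosXAddY, rescale_neg_cosX, rescale_neg_sinX] at h2
  rw [h2, mul_comm, ← smul_eq_mul]
  simp only [smul_zero, zero_add] at h1
  rw [h1]
  ring

theorem egfCoeff_succ_left (m l : ℕ) :
    egfCoeff (m + 1) l - egfCoeff m (l + 1) = (-1) ^ (m + l) * egfCoeff m l := by
  have h := congrArg (coeff (Finsupp.single 0 m + Finsupp.single 1 l)) diffDeriv_genFun
  rw [coeff_diffDeriv, coeff_rescale_two] at h
  have e1 : (Finsupp.single 0 m + Finsupp.single 1 l + Finsupp.single 0 1 : Fin 2 →₀ ℕ)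
      = Finsupp.single 0 (m + 1) + Finsupp.single 1 l := by
    rw [Finsupp.single_add]; abel
  have e2 : (Finsupp.single 0 m + Finsupp.single 1 l + Finsupp.single 1 1 : Fin 2 →₀ ℕ)
      = Finsupp.single 0 m + Finsupp.single 1 (l + 1) := by
    rw [Finsupp.single_add 1]; abel
  rw [e1, e2] at h
  simp only [Finsupp.add_apply, Finsupp.single_eq_same, ne_eq, zero_ne_one, one_ne_zero,
    not_false_eq_true, Finsupp.single_eq_of_ne, add_zero, zero_add] at h
  simp only [egfCoeff, Nat.factorial_succ, pow_add]
  push_cast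
  linear_combination (m.factorial * l.factorial : ℚ) * h

/-- `F (0, y) = 1 / cos y` is even. -/
theorem egfCoeff_zero_left {l : ℕ} (hl : Odd l) : egfCoeff 0 l = 0 := by
  have hX : rescale ![(0 : ℚ), 1] (cosX + sinX) = 1 := by
    ext e
    rw [coeff_rescale_two, map_add, coeff_cosX, coeff_sinX, coeff_one]
    have : e = 0 ↔ e 0 = 0 ∧ e 1 = 0 := by
      rw [Finsupp.ext_iff]; simp [Fin.forall_fin_two]
    by_cases h0 : e 0 = 0 <;> by_cases h1 : e 1 = 0 <;>
      simp [this, h0, h1, PowerSeries.cos, PowerSeries.sin]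
  have hmul := congrArg (rescale ![(0 : ℚ), 1]) genFun_mul_cosXAddY
  rw [hX, map_mul] at hmul
  set F := rescale ![(0 : ℚ), 1] genFun with hF
  set C := rescale ![(0 : ℚ), 1] cosXAddY with hC
  have hCneg : rescale ![(1 : ℚ), -1] C = C := by
    ext e
    rw [coeff_rescale_two, hC, coeff_rescale_two, coeff_cosXAddY]
    by_cases h0 : e 0 = 0
    · rcases Nat.even_or_odd (e 1) with h | h
      · simp [h0, h.neg_one_pow]
      · simp [h0, coeff_cos_of_odd h]
    · simp [h0]
  have hC0 : C ≠ 0 := by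
    rintro h
    rw [h] at hmul
    simp at hmul
  have hFneg : rescale ![(1 : ℚ), -1] F = F := by
    apply mul_right_cancel₀ hC0
    have h2 := congrArg (rescale ![(1 : ℚ), -1]) hmul
    rwa [map_mul, hCneg, map_one, ← hmul] at h2
  have h := congrArg (coeff (Finsupp.single 0 0 + Finsupp.single 1 l)) hFneg
  rw [coeff_rescale_two, hF, coeff_rescale_two] at h
  simp [hl.neg_one_pow] at h
  simp only [egfCoeff, Finsupp.single_zero, zero_add]
  have : coeff (Finsupp.single 1 l) genFun = 0 := by linarith
  rw [this, mul_zero]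

/-- `F (x, 0) - 1 = tan x` is odd. -/
theorem egfCoeff_zero_right {m : ℕ} (hm : Even m) (hm0 : m ≠ 0) : egfCoeff m 0 = 0 := by
  have hC : rescale ![(1 : ℚ), 0] cosXAddY = cosX := by
    ext e
    rw [coeff_rescale_two, coeff_cosX, coeff_cosXAddY]
    by_cases h1 : e 1 = 0 <;> simp [h1]
  have hX : rescale ![(1 : ℚ), 0] (cosX + sinX) = cosX + sinX := by
    ext e
    rw [coeff_rescale_two, map_add, coeff_cosX, coeff_sinX]
    by_cases h1 : e 1 = 0 <;> simp [h1]
  have hmul := congrArg (rescale ![(1 : ℚ), 0]) genFun_mul_cosXAddY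
  rw [hX, map_mul, hC] at hmul
  set F := rescale ![(1 : ℚ), 0] genFun with hF
  have hC0 : cosX ≠ 0 := by
    intro h
    have := coeff_cosX 0
    rw [h] at this
    simp [PowerSeries.cos] at this
  have hFneg : rescale ![(-1 : ℚ), 1] (F - 1) = -(F - 1) := by
    apply mul_right_cancel₀ hC0
    have h2 := congrArg (rescale ![(-1 : ℚ), 1]) hmul
    rw [map_mul, map_add, rescale_neg_cosX, rescale_neg_sinX] at h2
    rw [map_sub, map_one]
    linear_combination h2 + hmul
  have h := congrArg (coeff (Finsupp.single 0 m)) hFneg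
  have hne : (Finsupp.single 0 m : Fin 2 →₀ ℕ) ≠ 0 := by simpa using hm0
  rw [coeff_rescale_two, map_neg, map_sub, coeff_one, if_neg hne, hF, coeff_rescale_two] at h
  simp [hm.neg_one_pow] at h
  simp only [egfCoeff, Finsupp.single_zero, add_zero]
  have : coeff (Finsupp.single 0 m) genFun = 0 := by linarith
  rw [this, mul_zero]

theorem entringer_zero_zero : entringer 0 0 = 1 := by
  have h := congrArg constantCoeff genFun_mul_cosXAddY
  rw [map_mul, constantCoeff_cosXAddY, mul_one, map_add, ← coeff_zero_eq_constantCoeff_apply,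
    ← coeff_zero_eq_constantCoeff_apply, ← coeff_zero_eq_constantCoeff_apply, coeff_cosX,
    coeff_sinX] at h
  simp [PowerSeries.cos, PowerSeries.sin] at h
  simp [entringer, egfCoeff, h]

theorem entringer_zero_right {n : ℕ} (hn : n ≠ 0) : entringer n 0 = 0 := by
  unfold entringer
  split_ifs with h
  · exact egfCoeff_zero_left h
  · exact egfCoeff_zero_right (Nat.not_odd_iff_even.mp h) hn

/-- The boustrophedon recurrence of the Entringer numbers. -/
theorem entringer_succ_succ {n k : ℕ} (hk : k ≤ n) :
    entringer (n + 1) (k + 1) = entringer (n + 1) k + entringer n (n - k) := by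
  obtain ⟨l, rfl⟩ := Nat.exists_eq_add_of_le hk
  have h1 : k + l + 1 - (k + 1) = l := by omega
  have h2 : k + l + 1 - k = l + 1 := by omega
  have h3 : k + l - k = l := by omega
  have h4 : k + l - l = k := by omega
  unfold entringer
  rw [h1, h2, h3, h4]
  rcases Nat.even_or_odd (k + l) with h | h
  · rw [if_pos h.add_one, if_pos h.add_one, if_neg (Nat.not_odd_iff_even.mpr h)]
    have := egfCoeff_succ_left k l
    rw [h.neg_one_pow] at this
    linarith
  · have h' : ¬ Odd (k + l + 1) := Nat.not_odd_iff_even.mpr h.add_one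
    rw [if_neg h', if_neg h', if_pos h]
    have := egfCoeff_succ_left l k
    rw [add_comm l k, h.neg_one_pow] at this
    linarith

end Entringer

namespace WebPerm

open Finset

/-! ### Counting completions of words -/

section GetD

variable {α : Type*}

theorem getD_mem_of_lt {l : List α} {i : ℕ} (hi : i < l.length) (a : α) : l.getD i a ∈ l := by
  rw [List.getD_eq_getElem _ _ hi]
  exact List.getElem_mem hi

theorem getD_set_of_ne {l : List α} {i j : ℕ} (h : i ≠ j) (x d : α) :
    (l.set i x).getD j d = l.getD j d := by
  simp [List.getD_eq_getElem?_getD, List.getElem?_set_ne h]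

theorem getD_set_self {l : List α} {i : ℕ} (h : i < l.length) (x d : α) :
    (l.set i x).getD i d = x := by
  simp [List.getD_eq_getElem?_getD, h]

end GetD

section Count

variable {α β : Type*} [LinearOrder α] [LinearOrder β]

/-- The number of ways to complete the column process on a word. A word lists, from left to right,
the rows currently held by the columns that are still to be processed. Its first column either keeps
its row `a`, or exchanges it with the row of a later column that holds a row above `a`; then the first
column is dropped. (The default value in `getD` is harmless, since `a < a` fails.) -/
def completions : List α → ℕ
  | [] => 1
  | a :: l => completions l +
      ∑ i ∈ range l.length, if a < l.getD i a then completions (l.set i a) else 0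
termination_by l => l.length
decreasing_by all_goals simp

@[simp]
theorem completions_nil : completions ([] : List α) = 1 := by
  rw [completions]

theorem completions_cons (a : α) (l : List α) :
    completions (a :: l) = completions l +
      ∑ i ∈ range l.length, if a < l.getD i a then completions (l.set i a) else 0 := by
  rw [completions]

theorem completions_map {f : α → β} (hf : StrictMono f) (l : List α) :
    completions (l.map f) = completions l := by
  induction hn : l.length generalizing l with
  | zero => rw [List.length_eq_zero_iff.mp hn]; simp
  | succ n ih =>
    obtain ⟨a, t, rfl⟩ := List.exists_cons_of_length_eq_add_one hn
    have ht : t.length = n := by simpa using hn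
    rw [List.map_cons, completions_cons, completions_cons, ih t ht, List.length_map]
    congr 1
    refine sum_congr rfl fun i _ => ?_
    rw [List.getD_map, ← List.map_set, ih _ (by simpa using ht)]
    simp only [hf.lt_iff_lt]

/-- A letter `z` below all others in front of a word may be exchanged with every later letter. -/
theorem completions_cons_of_forall_lt {z : α} {l : List α} (hz : ∀ x ∈ l, z < x) :
    completions (z :: l) = completions l + ∑ i ∈ range l.length, completions (l.set i z) := by
  rw [completions_cons]
  congr 1
  refine sum_congr rfl fun i hi => ?_
  rw [if_pos (hz _ (getD_mem_of_lt (mem_range.mp hi) z))]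

theorem completions_cons_append (a : α) (u w : List α) :
    completions (a :: (u ++ w)) = completions (u ++ w)
      + (∑ i ∈ range u.length, if a < u.getD i a then completions (u.set i a ++ w) else 0)
      + ∑ j ∈ range w.length, if a < w.getD j a then completions (u ++ w.set j a) else 0 := by
  rw [completions_cons, List.length_append, sum_range_add, ← add_assoc]
  congr 1
  · congr 1
    refine sum_congr rfl fun i hi => ?_
    have hi' := mem_range.mp hi
    rw [List.getD_append _ _ _ _ hi', List.set_append_left _ _ hi']
  · refine sum_congr rfl fun j _ => ?_
    rw [List.getD_append_right _ _ _ _ (Nat.le_add_right _ _),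
      List.set_append_right _ _ (Nat.le_add_right _ _), Nat.add_sub_cancel_left]

theorem completions_cons_concat (a v : α) (l : List α) :
    completions (a :: (l ++ [v])) = completions (l ++ [v])
      + (∑ i ∈ range l.length, if a < l.getD i a then completions (l.set i a ++ [v]) else 0)
      + if a < v then completions (l ++ [a]) else 0 := by
  rw [completions_cons_append]
  simp

/-- Lowering a letter to `z` below the first letter `a` does not interfere with a choice for `a` at
another position. -/
theorem completions_cons_set {a z : α} (hza : z < a) {l : List α} {i : ℕ} (hi : i < l.length) :
    completions (a :: l.set i z) = completions (l.set i z) +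
      ∑ j ∈ range l.length, if i ≠ j ∧ a < l.getD j a then
        completions ((l.set j a).set i z) else 0 := by
  rw [completions_cons, List.length_set]
  congr 1
  refine sum_congr rfl fun j _ => ?_
  by_cases hij : i = j
  · subst hij
    rw [getD_set_self hi, if_neg hza.not_gt, if_neg (by simp)]
  · rw [getD_set_of_ne hij]
    simp only [ne_eq, hij, not_false_eq_true, true_and]
    rw [List.set_comm _ _ hij]

theorem sum_range_eq_add_of_notMem {a : α} {l : List α} (ha : a ∉ l) (f : ℕ → ℕ) :
    ∑ i ∈ range l.length, f i = (∑ i ∈ range l.length, if a < l.getD i a then f i else 0)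
      + ∑ i ∈ range l.length, if l.getD i a < a then f i else 0 := by
  rw [← sum_add_distrib]
  refine sum_congr rfl fun i hi => ?_
  have hne : l.getD i a ≠ a := fun h => ha (h ▸ getD_mem_of_lt (mem_range.mp hi) a)
  rcases lt_or_gt_of_ne hne with h | h
  · rw [if_neg h.not_gt, if_pos h, zero_add]
  · rw [if_pos h, if_neg h.not_gt, add_zero]

/-- Appending a letter `v`: with `z` smaller than all letters, the completions of `w ++ [v]` are
those of `w` and of the words in which a letter of `w` below `v` is lowered to `z`. -/
theorem completions_concat {z v : α} {w : List α} (hw : w.Nodup)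
    (hz : ∀ x ∈ w, z < x) :
    completions (w ++ [v]) = completions w +
      ∑ i ∈ range w.length, if w.getD i v < v then completions (w.set i z) else 0 := by
  induction hn : w.length generalizing w v with
  | zero =>
    rw [List.length_eq_zero_iff.mp hn]
    simp [completions_cons]
  | succ n ih =>
    obtain ⟨a, l, rfl⟩ := List.exists_cons_of_length_eq_add_one hn
    have hl : l.length = n := by simpa using hn
    have hza : z < a := hz a (by simp)
    obtain ⟨hal, hln⟩ := List.nodup_cons.mp hw
    have hzl : ∀ x ∈ l, z < x := fun x hx => hz x (by simp [hx])
    have hsetn : ∀ i, (l.set i a).Nodup := fun i => hln.set hal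
    have hzset : ∀ i, ∀ x ∈ l.set i a, z < x := fun i x hx => by
      rcases List.mem_or_eq_of_mem_set hx with h | rfl
      · exact hzl x h
      · exact hza
    rw [List.cons_append, completions_cons_concat, completions_cons, ih hln hzl hl, sum_range_succ']
    simp only [List.getD_cons_zero, List.getD_cons_succ, List.set_cons_zero, List.set_cons_succ]
    rw [completions_cons_of_forall_lt hzl, hl]
    -- Each choice for the first letter `a`, followed by the induction hypothesis. The term `i = j`
    -- lowers the letter `a` that has just been moved to position `j`, so it is split off.
    have hset : ∀ j ∈ range n, (if a < l.getD j a then completions (l.set j a ++ [v]) else 0)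
        = (if a < l.getD j a then completions (l.set j a) else 0)
          + ((∑ i ∈ range n, if i ≠ j ∧ l.getD i v < v ∧ a < l.getD j a then
              completions ((l.set j a).set i z) else 0)
            + if a < v ∧ a < l.getD j a then completions (l.set j z) else 0) := by
      intro j hj
      have hj' := mem_range.mp hj
      by_cases haj : a < l.getD j a
      · rw [if_pos haj, if_pos haj, ih (hsetn j) (hzset j) (by simpa using hl)]
        congr 1
        simp only [haj, and_true]
        rw [← add_sum_erase _ _ hj, ← add_sum_erase (range n) (fun i => ite (i ≠ j ∧ _) _ _) hj,
          getD_set_self (hl ▸ hj'), List.set_set]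
        simp only [ne_eq, not_true_eq_false, false_and, if_false, zero_add]
        rw [add_comm]
        congr 1
        refine sum_congr rfl fun i hi => ?_
        have hij : i ≠ j := (mem_erase.mp hi).1
        rw [getD_set_of_ne hij.symm]
        simp only [hij, not_false_eq_true, true_and]
      · simp only [haj, and_false, if_false, sum_const_zero, add_zero]
    rw [sum_congr rfl hset, sum_add_distrib, sum_add_distrib]
    -- The same expansion of the right-hand side, where lowering comes first.
    have hlow' : ∀ i ∈ range n, (if l.getD i v < v then completions (a :: l.set i z) else 0)
        = (if l.getD i v < v then completions (l.set i z) else 0)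
          + ∑ j ∈ range n, if i ≠ j ∧ l.getD i v < v ∧ a < l.getD j a then
              completions ((l.set j a).set i z) else 0 := by
      intro i hi
      by_cases hiv : l.getD i v < v
      · simp only [if_true, completions_cons_set hza (hl ▸ mem_range.mp hi), hl, hiv, true_and]
      · simp only [hiv, false_and, and_false, if_false, sum_const_zero, add_zero]
    rw [sum_congr rfl hlow', sum_add_distrib, sum_comm (s := range n) (t := range n)
      (f := fun i j => if i ≠ j ∧ l.getD i v < v ∧ a < l.getD j a then
              completions ((l.set j a).set i z) else 0)]
    by_cases hav : a < v
    -- If `a < v`, the choice of `v` for `a` leaves `l ++ [a]`. On the right it is matched by lowering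
    -- `a` itself, up to the diagonal terms split off above.
    · have hsplit := sum_range_eq_add_of_notMem hal fun i => completions (l.set i z)
      rw [hl] at hsplit
      rw [if_pos hav, if_pos hav, ih hln hzl hl, hsplit]
      simp only [hav, true_and]
      ring
    · simp only [hav, false_and, if_false, sum_const_zero, add_zero]
      ring

theorem forall_lt_set {z x : α} {l : List α} (hz : ∀ y ∈ l, z < y) (hx : z < x) (i : ℕ) :
    ∀ y ∈ l.set i x, z < y := fun y hy => by
  rcases List.mem_or_eq_of_mem_set hy with h | rfl
  · exact hz y h
  · exact hx

/-- The case of `completions_min_swap` in which `z` is the first letter. -/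
theorem completions_min_swap_of_head {z v : α} {w : List α} (hw : (v :: w).Nodup)
    (hz : ∀ x ∈ v :: w, z < x) :
    completions (z :: v :: w) = completions (v :: z :: w) + completions (w ++ [v]) := by
  obtain ⟨hvw, hwn⟩ := List.nodup_cons.mp hw
  have hzv : z < v := hz v (by simp)
  have hzw : ∀ x ∈ w, z < x := fun x hx => hz x (by simp [hx])
  rw [completions_cons_of_forall_lt hz, completions_cons v (z :: w), completions_concat hwn hzw,
    completions_cons v w, List.length_cons, List.length_cons, sum_range_succ', sum_range_succ']
  simp only [List.getD_cons_zero, List.getD_cons_succ, List.set_cons_zero, List.set_cons_succ,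
    hzv.not_gt, if_false, add_zero]
  have h1 : ∀ i ∈ range w.length, completions (v :: w.set i z) = completions (w.set i z) +
      ∑ j ∈ range w.length, if i ≠ j ∧ v < w.getD j v then
        completions ((w.set j v).set i z) else 0 :=
    fun i hi => completions_cons_set hzv (mem_range.mp hi)
  have h2 : ∀ j ∈ range w.length, (if v < w.getD j v then completions (z :: w.set j v) else 0)
      = (if v < w.getD j v then completions (w.set j v) else 0)
        + ((if v < w.getD j v then completions (w.set j z) else 0)
          + ∑ i ∈ range w.length, if i ≠ j ∧ v < w.getD j v then
            completions ((w.set j v).set i z) else 0) := by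
    intro j hj
    by_cases hvj : v < w.getD j v
    · simp only [hvj, if_true, and_true]
      rw [completions_cons_of_forall_lt (forall_lt_set hzw hzv j), List.length_set,
        ← add_sum_erase _ _ hj, ← add_sum_erase (range w.length) (fun i => ite (i ≠ j) _ _) hj,
        List.set_set]
      simp only [ne_eq, not_true_eq_false, if_false, zero_add]
      congr 2
      refine sum_congr rfl fun i hi => ?_
      rw [if_pos (mem_erase.mp hi).1]
    · simp only [hvj, and_false, if_false, sum_const_zero, add_zero]
  rw [sum_congr rfl h1, sum_congr rfl h2, sum_add_distrib, sum_add_distrib, sum_add_distrib,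
    sum_range_eq_add_of_notMem hvw fun i => completions (w.set i z),
    sum_comm (s := range w.length) (t := range w.length)
      (f := fun i j => if i ≠ j ∧ v < w.getD j v then completions ((w.set j v).set i z) else 0)]
  ring

/-- Moving the smallest letter `z` one step to the right, past `v`, loses as many completions as the
word has in which `z` is deleted and `v` is moved to the end. -/
theorem completions_min_swap {z v : α} {u w : List α} (hn : (u ++ v :: w).Nodup)
    (hz : ∀ x ∈ u ++ v :: w, z < x) :
    completions (u ++ z :: v :: w)
      = completions (u ++ v :: z :: w) + completions (u ++ (w ++ [v])) := by
  induction hl : u.length generalizing u v w with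
  | zero =>
    obtain rfl := List.length_eq_zero_iff.mp hl
    exact completions_min_swap_of_head hn hz
  | succ m ih =>
    obtain ⟨a, u, rfl⟩ := List.exists_cons_of_length_eq_add_one hl
    have hu : u.length = m := by simpa using hl
    rw [List.cons_append, List.nodup_cons] at hn
    obtain ⟨ha, hn⟩ := hn
    have hza : z < a := hz a (by simp)
    have hz' : ∀ x ∈ u ++ v :: w, z < x := fun x hx => hz x (List.mem_cons_of_mem _ hx)
    have hset : ∀ i, ((u ++ v :: w).set i a).Nodup := fun i => hn.set ha
    have hzset := fun i => forall_lt_set hz' hza i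
    have h1 : ∀ i ∈ range u.length,
        (if a < u.getD i a then completions (u.set i a ++ z :: v :: w) else 0)
        = (if a < u.getD i a then completions (u.set i a ++ v :: z :: w) else 0)
          + if a < u.getD i a then completions (u.set i a ++ (w ++ [v])) else 0 := by
      intro i hi
      have hi' := mem_range.mp hi
      split_ifs
      · refine ih ?_ ?_ (by simpa using hu)
        · rw [← List.set_append_left _ _ hi']; exact hset i
        · rw [← List.set_append_left _ _ hi']; exact hzset i
      · rfl
    have h2 : ∀ j ∈ range w.length,
        (if a < w.getD j a then completions (u ++ z :: v :: w.set j a) else 0)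
        = (if a < w.getD j a then completions (u ++ v :: z :: w.set j a) else 0)
          + if a < w.getD j a then completions (u ++ (w.set j a ++ [v])) else 0 := by
      intro j _
      have e : (u ++ v :: w).set (u.length + (j + 1)) a = u ++ v :: w.set j a := by
        rw [List.set_append_right _ _ (Nat.le_add_right _ _), Nat.add_sub_cancel_left]
        rfl
      split_ifs
      · refine ih ?_ ?_ hu
        · rw [← e]; exact hset _
        · rw [← e]; exact hzset _
      · rfl
    have h3 : completions (u ++ z :: a :: w)
        = completions (u ++ a :: z :: w) + completions (u ++ (w ++ [a])) := by
      have e : (u ++ v :: w).set u.length a = u ++ a :: w := by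
        rw [List.set_append_right _ _ le_rfl, Nat.sub_self]
        rfl
      refine ih ?_ ?_ hu
      · rw [← e]; exact hset _
      · rw [← e]; exact hzset _
    have h4 : ∀ j ∈ range w.length,
        (if a < (w ++ [v]).getD j a then completions (u ++ (w ++ [v]).set j a) else 0)
        = if a < w.getD j a then completions (u ++ (w.set j a ++ [v])) else 0 := by
      intro j hj
      have hj' := mem_range.mp hj
      rw [List.getD_append _ _ _ _ hj', List.set_append_left _ _ hj']
    have h5 : (w ++ [v]).getD w.length a = v ∧ (w ++ [v]).set w.length a = w ++ [a] := by
      rw [List.getD_append_right _ _ _ _ le_rfl, List.set_append_right _ _ le_rfl]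
      simp
    simp only [List.cons_append]
    rw [completions_cons_append, completions_cons_append, completions_cons_append, ih hn hz' hu,
      sum_congr rfl h1, sum_add_distrib]
    simp only [List.length_cons, List.length_append, List.length_nil, zero_add]
    rw [sum_range_succ', sum_range_succ', sum_range_succ', sum_range_succ', sum_range_succ,
      sum_congr rfl h4, h5.1, h5.2]
    simp only [List.getD_cons_zero, List.getD_cons_succ, List.set_cons_zero, List.set_cons_succ,
      hza.not_gt, if_false, add_zero]
    rw [sum_congr rfl h2, sum_add_distrib]
    split_ifs
    · rw [h3]
      ring
    · ring

end Count

/-! ### Words that are increasing up to one letter -/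

section Increasing

/-- The number of completions of the increasing word of length `m`. -/
def incCount (m : ℕ) : ℕ := completions (List.range' 1 m)

/-- The number of completions of the word in which the smallest letter stands behind `p` letters and
in front of `r` letters, the other letters being in increasing order. -/
def minInsertCount (p r : ℕ) : ℕ := completions (List.range' 1 p ++ 0 :: List.range' (p + 1) r)

/-- The number of completions of the word whose last letter is larger than `p` letters and smaller
than `r` letters, the other letters being in increasing order. -/
def lastLetterCount (p r : ℕ) : ℕ :=
  completions (List.range' 1 p ++ (List.range' (p + 2) r ++ [p + 1]))

/-- The increasing map `ℕ → ℕ` that leaves out the value `p + 1`. -/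
def skip (p x : ℕ) : ℕ := if x ≤ p then x else x + 1

theorem skip_strictMono (p : ℕ) : StrictMono (skip p) := by
  intro x y h
  unfold skip
  split_ifs <;> omega

theorem map_skip_range'_one (p : ℕ) : (List.range' 1 p).map (skip p) = List.range' 1 p := by
  conv_rhs => rw [← List.map_id (List.range' 1 p)]
  refine List.map_congr_left fun x hx => ?_
  rw [List.mem_range'_1] at hx
  simp only [skip, id]
  rw [if_pos (by omega)]

theorem map_skip_range'_succ (p r : ℕ) :
    (List.range' (p + 1) r).map (skip p) = List.range' (p + 2) r := by
  rw [show p + 2 = 1 + (p + 1) by ring, ← List.map_add_range' (p + 1) r 1]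
  refine List.map_congr_left fun x hx => ?_
  rw [List.mem_range'_1] at hx
  simp only [skip]
  rw [if_neg (by omega), add_comm]

theorem range'_one_add (p r : ℕ) :
    List.range' 1 (p + r) = List.range' 1 p ++ List.range' (p + 1) r := by
  rw [add_comm p 1, ← List.range'_append_1]

theorem map_skip_range' (p r : ℕ) :
    (List.range' 1 (p + r)).map (skip p) = List.range' 1 p ++ List.range' (p + 2) r := by
  rw [range'_one_add, List.map_append, map_skip_range'_one, map_skip_range'_succ]

theorem completions_set_zero (p r : ℕ) :
    completions ((List.range' 1 (p + (r + 1))).set p 0) = minInsertCount p r := by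
  rw [range'_one_add, List.set_append_right _ _ (by simp), List.length_range', Nat.sub_self,
    List.range'_succ, List.set_cons_zero, minInsertCount,
    ← completions_map (skip_strictMono p) (List.range' 1 p ++ 0 :: List.range' (p + 1) r),
    List.map_append, List.map_cons, map_skip_range'_one, map_skip_range'_succ]
  rfl

theorem lastLetterCount_eq (p r : ℕ) :
    lastLetterCount p r = incCount (p + r) + ∑ i ∈ range p, minInsertCount i (p + r - 1 - i) := by
  have hn : (List.range' 1 p ++ List.range' (p + 2) r).Nodup := by
    rw [← map_skip_range']
    exact List.Nodup.map (skip_strictMono p).injective List.nodup_range'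
  have hz : ∀ x ∈ List.range' 1 p ++ List.range' (p + 2) r, 0 < x := by
    intro x hx
    rw [List.mem_append, List.mem_range'_1, List.mem_range'_1] at hx
    omega
  rw [lastLetterCount, ← List.append_assoc, completions_concat hn hz, ← map_skip_range',
    completions_map (skip_strictMono p), List.length_map, List.length_range', sum_range_add,
    incCount]
  congr 1
  have h1 : ∀ i < p + r, ((List.range' 1 (p + r)).map (skip p)).getD i (p + 1) = skip p (1 + i) := by
    intro i hi
    rw [List.getD_eq_getElem _ _ (by simpa using hi)]
    simp
  rw [Finset.sum_eq_zero (s := range r), add_zero]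
  · refine sum_congr rfl fun i hi => ?_
    have hi' := mem_range.mp hi
    rw [if_pos]
    · rw [show (0 : ℕ) = skip p 0 by simp [skip], ← List.map_set,
        completions_map (skip_strictMono p), ← completions_set_zero]
      congr 3
      omega
    · rw [h1 i (by omega), skip, if_pos (by omega)]
      omega
  · intro j hj
    have hj' := mem_range.mp hj
    rw [if_neg]
    rw [h1 _ (by omega), skip, if_neg (by omega)]
    omega

theorem minInsertCount_succ (p r : ℕ) :
    minInsertCount p (r + 1) = minInsertCount (p + 1) r + lastLetterCount p r := by
  have e : List.range' 1 p ++ (p + 1) :: List.range' (p + 2) r = List.range' 1 (p + (r + 1)) := by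
    rw [range'_one_add, List.range'_succ]
  rw [minInsertCount, List.range'_succ, completions_min_swap]
  · rw [minInsertCount, lastLetterCount, range'_one_add p 1]
    simp
  · rw [e]
    exact List.nodup_range'
  · rw [e]
    intro x hx
    rw [List.mem_range'_1] at hx
    omega

theorem minInsertCount_zero_right (p : ℕ) : minInsertCount p 0 = incCount p := by
  rw [minInsertCount, List.range'_zero, completions_concat (z := 0) List.nodup_range']
  · simp [incCount]
  · intro x hx
    rw [List.mem_range'_1] at hx
    omega

theorem minInsertCount_zero_left (m : ℕ) : minInsertCount 0 m = incCount (m + 1) := by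
  rw [minInsertCount, incCount, ← completions_map (f := fun x => 1 + x) (l := _ ++ _)
    (fun _ _ h => by simpa using h)]
  simp [List.map_add_range', List.range'_succ]

/-- Both counts obey the same recurrence. It reflects the antidiagonal symmetry of the grid. -/
theorem minInsertCount_eq_lastLetterCount (p r : ℕ) :
    minInsertCount p r = lastLetterCount r p := by
  induction hm : p + r using Nat.strong_induction_on generalizing p r with
  | _ m ih =>
    induction r generalizing p with
    | zero => rw [minInsertCount_zero_right, lastLetterCount_eq]; simp
    | succ r ihr =>
      rw [minInsertCount_succ, ihr (p + 1) (by omega), ← ih (r + p) (by omega) r p rfl,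
        lastLetterCount_eq, lastLetterCount_eq, sum_range_succ,
        show r + (p + 1) = r + 1 + p by ring, show r + 1 + p - 1 - r = p by omega, add_assoc]

/-- The boustrophedon recurrence on the side of words. -/
theorem minInsertCount_succ_right (p r : ℕ) :
    minInsertCount p (r + 1) = minInsertCount (p + 1) r + minInsertCount r p := by
  rw [minInsertCount_succ, minInsertCount_eq_lastLetterCount r p]

end Increasing

end WebPerm

namespace WebPerm

open Finset

variable {n : ℕ}

/-! ### Resolving crossings in any order -/

section Resolving

theorem mem_crossings {σ : Equiv.Perm (Fin n)} {c : Cell n} :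
    c ∈ crossings σ ↔ σ c.1 < c.2 ∧ c.1 < σ.symm c.2 := by
  simp [crossings]

/-- The permutation after switching at `c`. -/
def switchPerm (σ : Equiv.Perm (Fin n)) (c : Cell n) : Equiv.Perm (Fin n) :=
  σ * Equiv.swap c.1 (σ.symm c.2)

theorem switchPerm_eq_swap_mul (σ : Equiv.Perm (Fin n)) (c : Cell n) :
    switchPerm σ c = Equiv.swap (σ c.1) c.2 * σ := by
  rw [switchPerm, Equiv.mul_swap_eq_swap_mul, Equiv.apply_symm_apply]

theorem switchPerm_symm_apply (σ : Equiv.Perm (Fin n)) (c : Cell n) (x : Fin n) :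
    (switchPerm σ c).symm x = Equiv.swap c.1 (σ.symm c.2) (σ.symm x) := by
  rw [switchPerm, Equiv.symm_apply_eq]
  simp

/-- Switching at `d` only affects crossings in the lower-right quadrant at `d`. -/
theorem mem_crossings_switchPerm {σ : Equiv.Perm (Fin n)} {d e : Cell n} (hd : d ∈ crossings σ)
    (h : ¬ CellGE d e) : e ∈ crossings (switchPerm σ d) ↔ e ∈ crossings σ := by
  rw [mem_crossings] at hd
  obtain ⟨hd1, hd2⟩ := hd
  rw [mem_crossings, mem_crossings, switchPerm_symm_apply]
  rw [CellGE, not_and_or, not_le, not_le] at h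
  rcases h with h | h
  · have hval : switchPerm σ d e.1 = σ e.1 := by
      rw [switchPerm, Equiv.Perm.mul_apply,
        Equiv.swap_apply_of_ne_of_ne h.ne (h.trans hd2).ne]
    rw [hval]
    refine and_congr_right fun _ => ?_
    by_cases h1 : σ.symm e.2 = d.1
    · rw [h1, Equiv.swap_apply_left]
      exact ⟨fun _ => h, fun _ => h.trans hd2⟩
    by_cases h2 : σ.symm e.2 = σ.symm d.2
    · rw [h2, Equiv.swap_apply_right]
      exact ⟨fun _ => h.trans hd2, fun _ => h⟩
    · rw [Equiv.swap_apply_of_ne_of_ne h1 h2]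
  · have h1 : σ.symm e.2 ≠ d.1 := by
      intro h1
      rw [Equiv.symm_apply_eq] at h1
      exact (hd1.trans h).ne h1.symm
    have h2 : σ.symm e.2 ≠ σ.symm d.2 := fun h2 => h.ne' (σ.symm.injective h2)
    rw [Equiv.swap_apply_of_ne_of_ne h1 h2]
    refine and_congr_left fun _ => ?_
    rw [switchPerm_eq_swap_mul, Equiv.Perm.mul_apply]
    by_cases h3 : σ e.1 = σ d.1
    · rw [h3, Equiv.swap_apply_left]
      exact ⟨fun _ => hd1.trans h, fun _ => h⟩
    by_cases h4 : σ e.1 = d.2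
    · rw [h4, Equiv.swap_apply_right]
      exact ⟨fun _ => h, fun _ => hd1.trans h⟩
    · rw [Equiv.swap_apply_of_ne_of_ne h3 h4]

theorem switchPerm_comm_of_lt {σ : Equiv.Perm (Fin n)} {c d : Cell n} (hc : c ∈ crossings σ)
    (hd : d ∈ crossings σ) (h1 : c.1 < d.1) (h2 : c.2 < d.2) :
    switchPerm (switchPerm σ d) c = switchPerm (switchPerm σ c) d := by
  rw [mem_crossings] at hc hd
  have e1 : switchPerm σ d c.1 = σ c.1 := by
    rw [switchPerm, Equiv.Perm.mul_apply,
      Equiv.swap_apply_of_ne_of_ne h1.ne (h1.trans hd.2).ne]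
  have e2 : Equiv.swap (σ c.1) c.2 d.2 = d.2 :=
    Equiv.swap_apply_of_ne_of_ne (hc.1.trans h2).ne' h2.ne'
  have e3 : switchPerm σ c d.1 = Equiv.swap (σ c.1) c.2 (σ d.1) := by
    rw [switchPerm_eq_swap_mul, Equiv.Perm.mul_apply]
  rw [switchPerm_eq_swap_mul _ c, e1, switchPerm_eq_swap_mul σ d,
    switchPerm_eq_swap_mul _ d, e3, switchPerm_eq_swap_mul σ c, ← mul_assoc, ← mul_assoc]
  congr 1
  rw [Equiv.mul_swap_eq_swap_mul, e2]

namespace GridConfig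

variable {G : GridConfig n} {c d : Cell n}

theorem mem_remaining : c ∈ G.remaining ↔ c ∈ crossings G.perm ∧ c ∉ G.elbows := by
  simp [remaining]

theorem IsMaximalCrossing.mem_crossings (hc : G.IsMaximalCrossing c) : c ∈ crossings G.perm :=
  (mem_remaining.mp hc.1).1

theorem IsMaximalCrossing.not_cellGE (hc : G.IsMaximalCrossing c) (hd : G.IsMaximalCrossing d)
    (hne : c ≠ d) : ¬ CellGE c d :=
  fun h => hne (hd.2 c hc.1 h)

theorem IsMaximalCrossing.smooth (hd : G.IsMaximalCrossing d) (hne : c ≠ d) :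
    (G.smooth c).IsMaximalCrossing d := by
  refine ⟨mem_remaining.mpr ⟨hd.mem_crossings, ?_⟩, fun e he hed => hd.2 e ?_ hed⟩
  · simpa [GridConfig.smooth, hne.symm] using (mem_remaining.mp hd.1).2
  · have := mem_remaining.mp he
    exact mem_remaining.mpr ⟨this.1, fun h => this.2 (mem_insert_of_mem h)⟩

theorem IsMaximalCrossing.switch (hc : G.IsMaximalCrossing c) (hd : G.IsMaximalCrossing d)
    (hne : c ≠ d) : (G.switch c).IsMaximalCrossing d := by
  have hcd := hc.not_cellGE hd hne
  refine ⟨mem_remaining.mpr ⟨(mem_crossings_switchPerm hc.mem_crossings hcd).mpr hd.mem_crossings,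
    (mem_remaining.mp hd.1).2⟩, fun e he hed => hd.2 e ?_ hed⟩
  have hce : ¬ CellGE c e := fun h => hcd ⟨h.1.trans hed.1, hed.2.trans h.2⟩
  have := mem_remaining.mp he
  exact mem_remaining.mpr ⟨(mem_crossings_switchPerm hc.mem_crossings hce).mp this.1, this.2⟩

theorem smooth_smooth_comm : (G.smooth c).smooth d = (G.smooth d).smooth c := by
  simp only [smooth, Finset.insert_comm]

theorem switch_switch_comm (hc : G.IsMaximalCrossing c) (hd : G.IsMaximalCrossing d)
    (hne : c ≠ d) : (G.switch c).switch d = (G.switch d).switch c := by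
  have hcd := hc.not_cellGE hd hne
  have hdc := hd.not_cellGE hc hne.symm
  rw [CellGE, not_and_or, not_le, not_le] at hcd hdc
  have key : switchPerm (switchPerm G.perm c) d = switchPerm (switchPerm G.perm d) c := by
    rcases hcd with h1 | h1
    · exact switchPerm_comm_of_lt hd.mem_crossings hc.mem_crossings h1
        (hdc.resolve_left h1.not_gt)
    · exact (switchPerm_comm_of_lt hc.mem_crossings hd.mem_crossings
        (hdc.resolve_right h1.not_gt) h1).symm
  exact GridConfig.ext key rfl

/-- The crossings of `G` can be resolved in such a way that the permutation becomes `τ`. -/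
def Reaches (G : GridConfig n) (τ : Equiv.Perm (Fin n)) : Prop :=
  Relation.ReflTransGen Resolves G ⟨τ, crossings τ⟩

/-- Any maximal crossing may be resolved first: distinct maximal crossings are incomparable, so
resolving one of them leaves the other one maximal, and the two resolutions commute. -/
theorem reaches_iff (hc : G.IsMaximalCrossing c) {τ : Equiv.Perm (Fin n)} :
    G.Reaches τ ↔ (G.smooth c).Reaches τ ∨ (G.switch c).Reaches τ := by
  constructor
  · intro h
    induction h using Relation.ReflTransGen.head_induction_on generalizing c with
    | refl => simpa [remaining] using hc.1
    | head hstep _ ih =>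
      cases hstep with
      | smooth d hd =>
        by_cases hcd : c = d
        · subst hcd
          exact Or.inl ‹_›
        · refine (ih (hc.smooth (Ne.symm hcd))).imp (fun h => ?_) (fun h => ?_)
          · rw [smooth_smooth_comm] at h
            exact h.head (Resolves.smooth _ d (hd.smooth hcd))
          · exact Relation.ReflTransGen.head (Resolves.smooth _ d (hc.switch hd hcd)) h
      | switch d hd =>
        by_cases hcd : c = d
        · subst hcd
          exact Or.inr ‹_›
        · refine (ih (hd.switch hc (Ne.symm hcd))).imp (fun h => ?_) (fun h => ?_)
          · exact Relation.ReflTransGen.head (Resolves.switch _ d (hd.smooth hcd)) h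
          · rw [switch_switch_comm hd hc (Ne.symm hcd)] at h
            exact h.head (Resolves.switch _ d (hc.switch hd hcd))
  · rintro (h | h)
    · exact Relation.ReflTransGen.head (Resolves.smooth _ c hc) h
    · exact Relation.ReflTransGen.head (Resolves.switch _ c hc) h

end GridConfig

end Resolving

/-! ### Resolving crossings column by column -/

section Columns

/-- The configuration with permutation `σ` in which precisely the crossings in the columns before `t`,
and those in column `t` from row `h` upwards, are elbows. -/
def columnConfig (σ : Equiv.Perm (Fin n)) (t h : ℕ) : GridConfig n :=
  ⟨σ, (crossings σ).filter fun c => (c.1 : ℕ) < t ∨ (c.1 : ℕ) = t ∧ h ≤ c.2⟩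

theorem mem_elbows_columnConfig {σ : Equiv.Perm (Fin n)} {t h : ℕ} {c : Cell n} :
    c ∈ (columnConfig σ t h).elbows ↔
      c ∈ crossings σ ∧ ((c.1 : ℕ) < t ∨ (c.1 : ℕ) = t ∧ h ≤ c.2) := by
  simp [columnConfig]

theorem columnConfig_zero (σ : Equiv.Perm (Fin n)) (t : ℕ) :
    columnConfig σ t 0 = columnConfig σ (t + 1) n := by
  refine GridConfig.ext rfl ?_
  ext c
  rw [mem_elbows_columnConfig, mem_elbows_columnConfig]
  have := c.2.isLt
  refine and_congr_right fun _ => ?_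
  omega

theorem columnConfig_last (σ : Equiv.Perm (Fin n)) :
    columnConfig σ n n = ⟨σ, crossings σ⟩ := by
  refine GridConfig.ext rfl ?_
  ext c
  rw [mem_elbows_columnConfig]
  simp

theorem columnConfig_init : columnConfig (1 : Equiv.Perm (Fin n)) 0 n = GridConfig.init n := by
  refine GridConfig.ext rfl ?_
  ext c
  rw [mem_elbows_columnConfig]
  have := c.2.isLt
  simp only [GridConfig.init, notMem_empty, iff_false]
  omega

section Step

variable {σ : Equiv.Perm (Fin n)} {t j : Fin n}

theorem isMaximalCrossing_columnConfig (hc : (t, j) ∈ crossings σ) :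
    (columnConfig σ t (j + 1)).IsMaximalCrossing (t, j) := by
  refine ⟨GridConfig.mem_remaining.mpr ⟨hc, ?_⟩, fun e he hle => ?_⟩
  · rw [mem_elbows_columnConfig]
    simp
  · obtain ⟨he1, he2⟩ := GridConfig.mem_remaining.mp he
    rw [mem_elbows_columnConfig] at he2
    have he3 : ¬ ((e.1 : ℕ) < t ∨ (e.1 : ℕ) = t ∧ (j : ℕ) + 1 ≤ e.2) := fun h => he2 ⟨he1, h⟩
    have h1 : (e.1 : ℕ) ≤ t := hle.1
    have h2 : (j : ℕ) ≤ e.2 := hle.2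
    ext
    · change (e.1 : ℕ) = t
      omega
    · change (e.2 : ℕ) = j
      omega

theorem columnConfig_smooth (hc : (t, j) ∈ crossings σ) :
    (columnConfig σ t (j + 1)).smooth (t, j) = columnConfig σ t j := by
  refine GridConfig.ext rfl ?_
  ext e
  rw [GridConfig.smooth, mem_insert, mem_elbows_columnConfig, mem_elbows_columnConfig, Prod.ext_iff,
    Fin.ext_iff, Fin.ext_iff]
  constructor
  · rintro (h | ⟨h1, h2⟩)
    · have : e = (t, j) := Prod.ext (Fin.ext h.1) (Fin.ext h.2)
      subst this
      exact ⟨hc, by simp⟩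
    · exact ⟨h1, by omega⟩
  · rintro ⟨h1, h2⟩
    simp only [h1, true_and]
    omega

theorem columnConfig_switch (hc : (t, j) ∈ crossings σ) :
    (columnConfig σ t (j + 1)).switch (t, j)
      = columnConfig (σ * Equiv.swap t (σ.symm j)) (t + 1) n := by
  refine GridConfig.ext rfl ?_
  ext e
  change e ∈ (columnConfig σ t (j + 1)).elbows ↔ e ∈ (columnConfig (switchPerm σ (t, j)) _ n).elbows
  rw [mem_elbows_columnConfig, mem_elbows_columnConfig]
  have hlt := e.2.isLt
  constructor
  · rintro ⟨h1, h2⟩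
    refine ⟨(mem_crossings_switchPerm hc ?_).mpr h1, by omega⟩
    rintro ⟨h3 : (t : ℕ) ≤ e.1, h4 : (e.2 : ℕ) ≤ j⟩
    omega
  · rintro ⟨h1, h2⟩
    have h3 : (e.1 : ℕ) < t ∨ (e.1 : ℕ) = t ∧ (j : ℕ) + 1 ≤ e.2 := by
      by_cases het : e.1 = t
      · right
        refine ⟨congrArg Fin.val het, ?_⟩
        have h4 := (mem_crossings.mp h1).1
        rw [switchPerm_eq_swap_mul, Equiv.Perm.mul_apply, het, Equiv.swap_apply_left] at h4
        exact h4
      · left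
        have : (e.1 : ℕ) ≠ t := fun h => het (Fin.ext h)
        omega
    refine ⟨(mem_crossings_switchPerm hc ?_).mp h1, h3⟩
    rintro ⟨h4 : (t : ℕ) ≤ e.1, h5 : (e.2 : ℕ) ≤ j⟩
    omega

end Step

/-- Working down column `t` from row `h`: either all its crossings are smoothed, or there is one switch,
which ends the treatment of the column. -/
theorem reaches_columnConfig_iff {σ τ : Equiv.Perm (Fin n)} (t : Fin n) {h : ℕ} (hh : h ≤ n) :
    (columnConfig σ t h).Reaches τ ↔ (columnConfig σ (t + 1) n).Reaches τ ∨
      ∃ y, t < y ∧ σ t < σ y ∧ (σ y : ℕ) < h ∧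
        (columnConfig (σ * Equiv.swap t y) (t + 1) n).Reaches τ := by
  induction h with
  | zero => simp [columnConfig_zero]
  | succ h ih =>
    specialize ih (by omega)
    set j : Fin n := ⟨h, hh⟩ with hj
    by_cases hc : (t, j) ∈ crossings σ
    · have hm := isMaximalCrossing_columnConfig hc
      have h1 := columnConfig_smooth hc
      have h2 := columnConfig_switch hc
      have hr := GridConfig.reaches_iff hm (τ := τ)
      rw [h1, h2] at hr
      obtain ⟨hc1, hc2⟩ := mem_crossings.mp hc
      change (columnConfig σ t (h + 1)).Reaches τ ↔ (columnConfig σ t h).Reaches τ ∨ _ at hr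
      rw [hr, ih, or_assoc]
      refine or_congr_right ⟨?_, ?_⟩
      · rintro (⟨y, hy1, hy2, hy3, hy4⟩ | h3)
        · exact ⟨y, hy1, hy2, by omega, hy4⟩
        · refine ⟨σ.symm j, hc2, ?_, ?_, h3⟩
          · rw [Equiv.apply_symm_apply]; exact hc1
          · rw [Equiv.apply_symm_apply]; simp [hj]
      · rintro ⟨y, hy1, hy2, hy3, hy4⟩
        by_cases hyj : σ y = j
        · right
          rwa [← hyj, Equiv.symm_apply_apply]
        · left
          have : (σ y : ℕ) ≠ h := fun h' => hyj (Fin.ext h')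
          exact ⟨y, hy1, hy2, by omega, hy4⟩
    · have h1 : columnConfig σ t (h + 1) = columnConfig σ t h := by
        refine GridConfig.ext rfl ?_
        ext e
        rw [mem_elbows_columnConfig, mem_elbows_columnConfig]
        refine and_congr_right fun he => ?_
        have : ¬ ((e.1 : ℕ) = t ∧ (e.2 : ℕ) = h) := by
          rintro ⟨h1, h2⟩
          have : e = (t, j) := Prod.ext (Fin.ext h1) (Fin.ext h2)
          exact hc (this ▸ he)
        omega
      rw [h1, ih]
      refine or_congr_right (exists_congr fun y => and_congr_right fun hy1 =>
        and_congr_right fun hy2 => and_congr_left fun _ => ?_)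
      have : (σ y : ℕ) ≠ h := by
        intro h'
        have hyj : σ y = j := Fin.ext h'
        refine hc (mem_crossings.mpr ⟨hyj ▸ hy2, ?_⟩)
        rw [← hyj]
        simpa using hy1
      omega

/-- The permutations obtained from `σ` when the columns in the list are processed one after the other:
column `t` may exchange its row with that of a later column that holds a row above `σ t`. -/
def columnOutcomes : List (Fin n) → Equiv.Perm (Fin n) → Finset (Equiv.Perm (Fin n))
  | [], σ => {σ}
  | t :: ts, σ => ((t :: ts).toFinset.filter fun y => σ t ≤ σ y).biUnion
      fun y => columnOutcomes ts (σ * Equiv.swap t y)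

theorem mem_columnOutcomes_cons {t : Fin n} {ts : List (Fin n)} {σ τ : Equiv.Perm (Fin n)} :
    τ ∈ columnOutcomes (t :: ts) σ ↔
      ∃ y ∈ t :: ts, σ t ≤ σ y ∧ τ ∈ columnOutcomes ts (σ * Equiv.swap t y) := by
  simp only [columnOutcomes, mem_biUnion, mem_filter, List.mem_toFinset, and_assoc]

theorem reaches_columnConfig_iff_mem {t : ℕ} (ht : t ≤ n) {σ τ : Equiv.Perm (Fin n)} :
    (columnConfig σ t n).Reaches τ ↔ τ ∈ columnOutcomes ((List.finRange n).drop t) σ := by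
  induction ht using Nat.decreasingInduction generalizing σ with
  | self =>
    rw [columnConfig_last, List.drop_of_length_le (by simp), columnOutcomes, mem_singleton]
    refine ⟨fun h => ?_, fun h => h ▸ Relation.ReflTransGen.refl⟩
    rcases Relation.ReflTransGen.cases_head h with h | ⟨G, hG, -⟩
    · exact (congrArg GridConfig.perm h).symm
    · have hno : ∀ c, ¬ (⟨σ, crossings σ⟩ : GridConfig n).IsMaximalCrossing c := fun c hc => by
        simpa [GridConfig.remaining] using hc.1
      cases hG with
      | smooth c hc => exact (hno c hc).elim
      | switch c hc => exact (hno c hc).elim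
  | of_succ t ht ih =>
    have hdrop : (List.finRange n).drop t = ⟨t, ht⟩ :: (List.finRange n).drop (t + 1) := by
      rw [List.drop_eq_getElem_cons (by simpa using ht)]
      simp
    have hmem : ∀ y, y ∈ (List.finRange n).drop (t + 1) ↔ t < (y : ℕ) := by
      intro y
      rw [List.mem_drop_iff_getElem]
      constructor
      · rintro ⟨i, hi, rfl⟩
        simp
        omega
      · intro hy
        refine ⟨y - (t + 1), by simp; omega, ?_⟩
        ext
        simp
        omega
    have h := reaches_columnConfig_iff (σ := σ) (τ := τ) ⟨t, ht⟩ le_rfl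
    change (columnConfig σ t n).Reaches τ ↔ _ at h
    rw [h, hdrop, mem_columnOutcomes_cons]
    simp only [ih]
    have hself : σ * Equiv.swap ⟨t, ht⟩ ⟨t, ht⟩ = σ := by
      rw [Equiv.swap_self]
      rfl
    constructor
    · rintro (h | ⟨y, hy1, hy2, -, hy3⟩)
      · exact ⟨_, List.mem_cons_self, le_rfl, by rwa [hself]⟩
      · exact ⟨y, List.mem_cons_of_mem _ ((hmem y).mpr hy1), hy2.le, hy3⟩
    · rintro ⟨y, hy1, hy2, hy3⟩
      rcases List.mem_cons.mp hy1 with rfl | hy1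
      · left
        rwa [hself] at hy3
      · right
        have hy4 : (⟨t, ht⟩ : Fin n) < y := (hmem y).mp hy1
        exact ⟨y, hy4, lt_of_le_of_ne hy2 (σ.injective.ne hy4.ne), (σ y).isLt, hy3⟩

theorem isWeb_iff_mem_columnOutcomes {τ : Equiv.Perm (Fin n)} :
    IsWeb τ ↔ τ ∈ columnOutcomes (List.finRange n) 1 := by
  have h := reaches_columnConfig_iff_mem (Nat.zero_le n) (σ := 1) (τ := τ)
  rwa [columnConfig_init, List.drop_zero] at h

theorem apply_eq_of_mem_columnOutcomes {L : List (Fin n)} {σ τ : Equiv.Perm (Fin n)}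
    (h : τ ∈ columnOutcomes L σ) {x : Fin n} (hx : x ∉ L) : τ x = σ x := by
  induction L generalizing σ with
  | nil => rw [columnOutcomes, mem_singleton] at h; rw [h]
  | cons t ts ih =>
    obtain ⟨y, hy, -, h⟩ := mem_columnOutcomes_cons.mp h
    rw [ih h fun h' => hx (List.mem_cons_of_mem _ h'), Equiv.Perm.mul_apply,
      Equiv.swap_apply_of_ne_of_ne (fun h' => hx (by rw [h']; exact List.mem_cons_self))
        (fun h' => hx (by rw [h']; exact hy))]

theorem apply_head_of_mem_columnOutcomes {t : Fin n} {ts : List (Fin n)} (ht : t ∉ ts)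
    {σ τ : Equiv.Perm (Fin n)} {y : Fin n} (h : τ ∈ columnOutcomes ts (σ * Equiv.swap t y)) :
    τ t = σ y := by
  rw [apply_eq_of_mem_columnOutcomes h ht]
  simp

/-- After a column is processed, its row is final; hence different choices have different outcomes, and
the outcomes are counted by the completions of the word of rows held by the columns. -/
theorem card_columnOutcomes {L : List (Fin n)} (hL : L.Nodup) (σ : Equiv.Perm (Fin n)) :
    (columnOutcomes L σ).card = completions (L.map σ) := by
  induction L generalizing σ with
  | nil => simp [columnOutcomes]
  | cons t ts ih =>
    obtain ⟨ht, hts⟩ := List.nodup_cons.mp hL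
    rw [columnOutcomes, card_biUnion]
    · rw [sum_filter, List.toFinset_cons, sum_insert (by simpa using ht), if_pos le_rfl, ih hts,
        Equiv.swap_self, List.map_cons, completions_cons, List.sum_toFinset _ hts,
        ← Fin.sum_univ_fun_getElem, Finset.sum_range, List.length_map]
      congr 1
      refine sum_congr rfl fun i _ => ?_
      have hne : ts[(i : ℕ)] ≠ t := fun h => ht (h ▸ List.getElem_mem _)
      have hget : (ts.map σ).getD i (σ t) = σ ts[(i : ℕ)] := by
        rw [List.getD_eq_getElem _ _ (by simp), List.getElem_map]
      have hset : ts.map (σ * Equiv.swap t ts[(i : ℕ)]) = (ts.map σ).set i (σ t) := by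
        refine List.ext_getElem (by simp) fun k hk _ => ?_
        rw [List.length_map] at hk
        rw [List.getElem_map, List.getElem_set, Equiv.Perm.mul_apply]
        split_ifs with hik
        · simp [← hik]
        · rw [Equiv.swap_apply_of_ne_of_ne, List.getElem_map]
          · exact fun h => ht (h ▸ List.getElem_mem _)
          · exact fun h => hik (hts.getElem_inj_iff.mp h).symm
      rw [hget, ih hts, hset]
      have hiff : σ t ≤ σ ts[(i : ℕ)] ↔ σ t < σ ts[(i : ℕ)] :=
        ⟨fun h => lt_of_le_of_ne h (σ.injective.ne hne.symm), le_of_lt⟩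
      simp only [hiff]
    · intro y _ y' _ hne
      rw [Function.onFun, disjoint_left]
      intro τ h h'
      rw [← σ.injective.ne_iff, ← apply_head_of_mem_columnOutcomes ht h,
        ← apply_head_of_mem_columnOutcomes ht h'] at hne
      exact hne rfl

end Columns

/-! ### Web permutations with a given first value -/

section FirstValue

theorem isWeb_and_apply_zero_iff {m : ℕ} {τ : Equiv.Perm (Fin (m + 1))} {j : Fin (m + 1)} :
    IsWeb τ ∧ τ 0 = j ↔
      τ ∈ columnOutcomes ((List.finRange m).map Fin.succ) (Equiv.swap 0 j) := by
  have h0 : (0 : Fin (m + 1)) ∉ (List.finRange m).map Fin.succ := by simp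
  rw [isWeb_iff_mem_columnOutcomes, List.finRange_succ, mem_columnOutcomes_cons]
  constructor
  · rintro ⟨⟨y, -, -, h⟩, rfl⟩
    have hy := apply_head_of_mem_columnOutcomes h0 h
    rw [Equiv.Perm.one_apply] at hy
    rwa [one_mul, ← hy] at h
  · intro h
    rw [← one_mul (Equiv.swap 0 j)] at h
    refine ⟨⟨j, ?_, Fin.zero_le _, h⟩, apply_head_of_mem_columnOutcomes h0 h⟩
    rw [← List.finRange_succ]
    exact List.mem_finRange j

theorem card_isWeb_apply_zero {m : ℕ} (j : Fin (m + 1)) :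
    Nat.card {σ : Equiv.Perm (Fin (m + 1)) // IsWeb σ ∧ σ 0 = j}
      = completions (((List.finRange m).map Fin.succ).map (Equiv.swap 0 j)) := by
  rw [Nat.card_congr (Equiv.subtypeEquivRight fun _ => isWeb_and_apply_zero_iff),
    Nat.card_eq_fintype_card, Fintype.card_coe, card_columnOutcomes]
  exact (List.nodup_finRange m).map (Fin.succ_injective m)

theorem card_isWeb_apply_zero_eq_zero (m : ℕ) :
    Nat.card {σ : Equiv.Perm (Fin (m + 1)) // IsWeb σ ∧ σ 0 = 0} = incCount m := by
  rw [card_isWeb_apply_zero, ← completions_map Fin.val_strictMono, incCount]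
  congr 1
  refine List.ext_getElem (by simp) fun i hi hi' => ?_
  simp [add_comm]

theorem card_isWeb_apply_zero_eq_succ (p r : ℕ) (j : Fin (p + (r + 1) + 1)) (hj : (j : ℕ) = p + 1) :
    Nat.card {σ : Equiv.Perm (Fin (p + (r + 1) + 1)) // IsWeb σ ∧ σ 0 = j}
      = minInsertCount p r := by
  rw [card_isWeb_apply_zero, ← completions_map Fin.val_strictMono, ← completions_set_zero]
  congr 1
  refine List.ext_getElem (by simp) fun i hi hi' => ?_
  simp only [List.getElem_map, List.getElem_finRange, List.getElem_set, List.getElem_range']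
  split_ifs with hip
  · rw [show Fin.succ _ = j from Fin.ext (by simp [hj, hip]), Equiv.swap_apply_right]
    rfl
  · rw [Equiv.swap_apply_of_ne_of_ne]
    · simp [add_comm]
    · exact Fin.succ_ne_zero _
    · intro h
      have := congrArg Fin.val h
      simp [hj] at this
      omega

/-- The Entringer numbers as counts of completions, by comparing boustrophedon recurrences. -/
theorem entringer_eq_completions (m : ℕ) :
    Entringer.entringer (m + 1) (m + 1) = incCount m ∧
      ∀ p r, p + r = m → Entringer.entringer (m + 2) (r + 1) = minInsertCount p r := by
  induction m using Nat.strong_induction_on with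
  | _ m ih =>
    have h1 : Entringer.entringer (m + 1) (m + 1) = incCount m := by
      rw [Entringer.entringer_succ_succ le_rfl, Nat.sub_self]
      rcases m with _ | m
      · rw [Entringer.entringer_zero_right (Nat.succ_ne_zero 0), Entringer.entringer_zero_zero]
        simp [incCount]
      · rw [Entringer.entringer_zero_right (Nat.succ_ne_zero m),
          (ih m (Nat.lt_succ_self m)).2 0 m (by omega), minInsertCount_zero_left, add_zero]
    refine ⟨h1, fun p r => ?_⟩
    induction r generalizing p with
    | zero =>
      rintro rfl
      rw [Entringer.entringer_succ_succ (Nat.zero_le _), Nat.sub_zero, h1,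
        Entringer.entringer_zero_right (Nat.succ_ne_zero _), minInsertCount_zero_right]
      simp
    | succ r ihr =>
      intro h
      obtain rfl : m = r + p + 1 := by omega
      rw [Entringer.entringer_succ_succ (by omega), ihr (p + 1) (by omega),
        show r + p + 1 + 1 - (r + 1) = p + 1 by omega, (ih (r + p) (by omega)).2 r p rfl,
        minInsertCount_succ_right, Nat.cast_add]

end FirstValue

end WebPerm

theorem corollary4p4 (n k : ℕ) (hn : 0 < n) (hk : k ≤ n) :
    Entringer.entringer n k =
      (Nat.card {σ : Equiv.Perm (Fin n) //
        WebPerm.IsWeb σ ∧ (σ ⟨0, hn⟩ : ℕ) + 1 = n + 1 - k} : ℚ) := by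
  obtain ⟨m, rfl⟩ := Nat.exists_eq_add_one_of_ne_zero hn.ne'
  change _ = (Nat.card {σ : Equiv.Perm (Fin (m + 1)) //
        WebPerm.IsWeb σ ∧ (σ 0 : ℕ) + 1 = m + 1 + 1 - k} : ℚ)
  rcases k with _ | r
  · have : IsEmpty {σ : Equiv.Perm (Fin (m + 1)) //
        WebPerm.IsWeb σ ∧ (σ 0 : ℕ) + 1 = m + 1 + 1 - 0} := by
      refine ⟨fun ⟨σ, _, h⟩ => ?_⟩
      have := (σ 0).isLt
      omega
    rw [Entringer.entringer_zero_right (Nat.succ_ne_zero m), Nat.card_of_isEmpty, Nat.cast_zero]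
  · have hcard : ∀ j : Fin (m + 1), (j : ℕ) = m - r →
        Nat.card {σ : Equiv.Perm (Fin (m + 1)) //
          WebPerm.IsWeb σ ∧ (σ 0 : ℕ) + 1 = m + 1 + 1 - (r + 1)}
        = Nat.card {σ : Equiv.Perm (Fin (m + 1)) // WebPerm.IsWeb σ ∧ σ 0 = j} := by
      intro j hj
      refine Nat.card_congr (Equiv.subtypeEquivRight fun σ => and_congr_right fun _ => ?_)
      rw [Fin.ext_iff, hj]
      omega
    rcases (Nat.le_of_succ_le_succ hk).eq_or_lt with rfl | hr
    · rw [hcard 0 (by simp), WebPerm.card_isWeb_apply_zero_eq_zero,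
        (WebPerm.entringer_eq_completions r).1]
    · obtain ⟨p, rfl⟩ : ∃ p, m = p + (r + 1) := ⟨m - (r + 1), by omega⟩
      rw [hcard ⟨p + 1, by omega⟩ (by simp only; omega),
        WebPerm.card_isWeb_apply_zero_eq_succ p r _ rfl,
        ← (WebPerm.entringer_eq_completions (p + r)).2 p r rfl]
      rfl
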